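/- Let $\mathbb{D}\subseteq\mathbb{Z}_+$ be a set of dimensions, let $\mathcal{H}_d=\mathbb{C}^d$, and let $\mathcal{D}(\mathcal{H}_d)$ be the set of density operators on $\mathcal{H}_d$. A resource theory specifies, for each $d\in\mathbb{D}$, a nonempty closed set $\mathcal{F}=\mathcal{F}(\mathcal{H}_d)\subseteq\mathcal{D}(\mathcal{H}_d)$ of free states. For states $\rho,\sigma$ let $$f(\rho,\sigma)=\Bigl(\operatorname{Tr}\sqrt{\sqrt\sigma\rho\sqrt\sigma}\Bigr)^2,\qquad D_{\max}(\rho\|\sigma)=\log\min\{c:\rho\le c\,\sigma\},\qquad D_{\min}(\rho\|\sigma)=-\log\operatorname{Tr}(\Pi_\rho\sigma),$$ where $\Pi_\rho$ is the projector onto $\operatorname{supp}\rho$, and let $D(\rho\|\sigma)=\operatorname{Tr}(\rho\log\rho-\rho\log\sigma)$ be the relative entropy. All logarithms are to one fixed base $>1$. The values are in $(-\infty,+\infty]$: $-\log 0=+\infty$, $D_{\max}(\rho\|\sigma)=+\infty$ if no such $c$ exists, and $D(\rho\|\sigma)=+\infty$ unless $\operatorname{supp}\rho\subseteq\operatorname{supp}\sigma$.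 For $d\ge 2$ define the modification coefficients of $\rho\in\mathcal{D}(\mathcal{H}_d)$ by $$m_f(\rho)=\frac{-\log\max_{\sigma\in\mathcal{F}}f(\rho,\sigma)}{\log d},\qquad m_{\min}(\rho)=\frac{\min_{\sigma\in\mathcal{F}}D_{\min}(\rho\|\sigma)}{\log d},\qquad m_{\max}(\rho)=\frac{\min_{\sigma\in\mathcal{F}}D_{\max}(\rho\|\sigma)}{\log d},$$ and, for a map $\lambda:\mathcal{D}(\mathcal{H}_d)\to\mathcal{D}(\mathcal{H}_d)$, $$m_{f,\lambda}(\rho)=\frac{-\log f(\rho,\lambda(\rho))}{\log d},\qquad m_{\min,\lambda}(\rho)=\frac{D_{\min}(\rho\|\lambda(\rho))}{\log d},\qquad m_{\max,\lambda}(\rho)=\frac{D_{\max}(\rho\|\lambda(\rho))}{\log d}.$$ The map $\lambda$ is a resource destroying map if $\lambda(\rho)\in\mathcal{F}$ for every $\rho\notin\mathcal{F}$ and $\lambda(\sigma)=\sigma$ for every $\sigma\in\mathcal{F}$; it is exact if moreover $D(\rho\|\lambda(\rho))=\min_{\sigma\in\mathcal{F}}D(\rho\|\sigma)$ for every state $\rho$.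 Theorem. Suppose that for every $d\in\mathbb{D}$ the set $\mathcal{F}(\mathcal{H}_d)$ is the convex hull of the pure states it contains (Condition (CH)). Then for every $d\in\mathbb{D}$ with $d\ge 2$ there exist a pure state $\hat\Phi_d\in\mathcal{D}(\mathcal{H}_d)$ and a value $g_d$ such that $$m_f(\hat\Phi_d)=m_{\min}(\hat\Phi_d)=m_{\max}(\hat\Phi_d)=g_d,$$ and $\hat\Phi_d$ attains the maxima of $m_f$, $m_{\min}$ and $m_{\max}$ over $\mathcal{D}(\mathcal{H}_d)$. Furthermore, for every exact resource destroying map $\tilde\lambda$ on $\mathcal{D}(\mathcal{H}_d)$, $$m_{f,\tilde\lambda}(\hat\Phi_d)=m_{\min,\tilde\lambda}(\hat\Phi_d)=m_{\max,\tilde\lambda}(\hat\Phi_d)=g_d.$$ -/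

import Mathlib

open scoped ComplexOrder ENNReal NNReal Matrix

noncomputable section

namespace QResource

/-- Operators on the `d`-dimensional Hilbert space `ℂ^d`. -/
abbrev Op (d : ℕ) : Type := Matrix (Fin d) (Fin d) ℂ

/-- The set `𝒟(ℋ_d)` of density operators. -/
def densityOps (d : ℕ) : Set (Op d) := {ρ | ρ.PosSemidef ∧ ρ.trace = 1}

/-- `ρ = |ψ⟩⟨ψ|` for a unit vector `ψ`. -/
def IsPure {d : ℕ} (ρ : Op d) : Prop :=
  ∃ ψ : Fin d → ℂ, star ψ ⬝ᵥ ψ = 1 ∧ ρ = Matrix.vecMulVec ψ (star ψ)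

/-- The support of a Hermitian operator, i.e. its range, as a subspace of `ℂ^d` with the standard
inner product. -/
def supp {d : ℕ} (ρ : Op d) : Submodule ℂ (EuclideanSpace ℂ (Fin d)) :=
  LinearMap.range (Matrix.toEuclideanLin ρ)

/-- The matrix of the orthogonal projector `Π_ρ` onto the support of `ρ`. -/
def suppProj {d : ℕ} (ρ : Op d) : Op d :=
  Matrix.toEuclideanLin.symm ((supp ρ).starProjection : EuclideanSpace ℂ (Fin d) →ₗ[ℂ] _)

/-- The Uhlmann fidelity `(Tr √(√σ ρ √σ))²`. -/
def fidelity {d : ℕ} (ρ σ : Op d) : ℝ :=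
  (cfc Real.sqrt (cfc Real.sqrt σ * ρ * cfc Real.sqrt σ)).trace.re ^ 2

/-- The max-relative entropy `log min {c : ρ ≤ c σ}`, which is `+∞` if there is no such `c`.
The logarithm is natural here and everywhere below. -/
def Dmax {d : ℕ} (ρ σ : Op d) : EReal :=
  ENNReal.log (⨅ (c : ℝ≥0) (_ : ((c : ℝ) • σ - ρ).PosSemidef), (c : ℝ≥0∞))

/-- The min-relative entropy `-log Tr (Π_ρ σ)`, which is `+∞` if the trace is `0`. -/
def Dmin {d : ℕ} (ρ σ : Op d) : EReal :=
  -ENNReal.log (ENNReal.ofReal (suppProj ρ * σ).trace.re)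

open Classical in
/-- The relative entropy `Tr (ρ log ρ - ρ log σ)`, which is `+∞` unless `supp ρ ⊆ supp σ`. Since
`Real.log 0 = 0`, logarithms of operators are taken on their supports. -/
def relEntropy {d : ℕ} (ρ σ : Op d) : EReal :=
  if supp ρ ≤ supp σ then
    (((ρ * cfc Real.log ρ - ρ * cfc Real.log σ).trace.re : ℝ) : EReal)
  else ⊤

/-- The free fidelity `max_{σ ∈ F} f(ρ, σ)`. -/
def freeFidelity {d : ℕ} (F : Set (Op d)) (ρ : Op d) : ℝ≥0∞ :=
  ⨆ σ ∈ F, ENNReal.ofReal (fidelity ρ σ)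

/-- The max-relative entropy of resource `min_{σ ∈ F} D_max(ρ ‖ σ)`. -/
def resDmax {d : ℕ} (F : Set (Op d)) (ρ : Op d) : EReal := ⨅ σ ∈ F, Dmax ρ σ

/-- The min-relative entropy of resource `min_{σ ∈ F} D_min(ρ ‖ σ)`. -/
def resDmin {d : ℕ} (F : Set (Op d)) (ρ : Op d) : EReal := ⨅ σ ∈ F, Dmin ρ σ

/-- The fidelity modification coefficient `-log f(ρ) / log d`. -/
def mF {d : ℕ} (F : Set (Op d)) (ρ : Op d) : EReal :=
  -ENNReal.log (freeFidelity F ρ) / (Real.log d : EReal)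

/-- The modification coefficient of the min-relative entropy. -/
def mMin {d : ℕ} (F : Set (Op d)) (ρ : Op d) : EReal := resDmin F ρ / (Real.log d : EReal)

/-- The modification coefficient of the max-relative entropy. -/
def mMax {d : ℕ} (F : Set (Op d)) (ρ : Op d) : EReal := resDmax F ρ / (Real.log d : EReal)

/-- `-log f(ρ, Λ(ρ)) / log d`. -/
def mFMap {d : ℕ} (Λ : Op d → Op d) (ρ : Op d) : EReal :=
  -ENNReal.log (ENNReal.ofReal (fidelity ρ (Λ ρ))) / (Real.log d : EReal)

/-- `D_min(ρ ‖ Λ(ρ)) / log d`. -/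
def mMinMap {d : ℕ} (Λ : Op d → Op d) (ρ : Op d) : EReal := Dmin ρ (Λ ρ) / (Real.log d : EReal)

/-- `D_max(ρ ‖ Λ(ρ)) / log d`. -/
def mMaxMap {d : ℕ} (Λ : Op d → Op d) (ρ : Op d) : EReal := Dmax ρ (Λ ρ) / (Real.log d : EReal)

/-- A resource destroying map on `𝒟(ℋ_d)` for the set `F` of free states: it sends states to
states, non-free states to free states, and fixes free states. (Its values at operators that are
not states are irrelevant.) -/
structure IsRDMap {d : ℕ} (F : Set (Op d)) (Λ : Op d → Op d) : Prop where
  mapsTo : Set.MapsTo Λ (densityOps d) (densityOps d)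
  destroys : ∀ ρ ∈ densityOps d, ρ ∉ F → Λ ρ ∈ F
  fixes : ∀ σ ∈ F, Λ σ = σ

/-- An exact resource destroying map: it sends each state to a closest free state with respect to
the relative entropy. -/
structure IsExactRDMap {d : ℕ} (F : Set (Op d)) (Λ : Op d → Op d) : Prop extends
    IsRDMap F Λ where
  closest : ∀ ρ ∈ densityOps d, relEntropy ρ (Λ ρ) = ⨅ σ ∈ F, relEntropy ρ σ

/-- The free states of a resource theory: a set of valid dimensions and, for each of them, a
nonempty closed set of density operators. -/
structure ResourceTheory where
  dims : Set ℕ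
  free : (d : ℕ) → Set (Op d)
  free_subset : ∀ d ∈ dims, free d ⊆ densityOps d
  free_nonempty : ∀ d ∈ dims, (free d).Nonempty
  free_closed : ∀ d ∈ dims, IsClosed (free d)

/-- Condition (CH): in every valid dimension the set of free states is the convex hull of the pure
free states. -/
def ResourceTheory.ConditionCH (R : ResourceTheory) : Prop :=
  ∀ d ∈ R.dims, R.free d = convexHull ℝ {φ | φ ∈ R.free d ∧ IsPure φ}

end QResource

end

/-! Choose a unit vector `ψ` whose largest overlap `m = max ⟨ψ|σ|ψ⟩` with the free states is as
small as possible; the golden state is `Φ = |ψ⟩⟨ψ|` and `g = -log m / log d`. Condition (CH) enters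
through the convexity of the free set.

The core is a duality argument (`exists_posSemidef_sub_smul`): when `m > 0`, every state `ρ`
satisfies `m ρ ≤ σ` for some free `σ`. Otherwise Hahn–Banach separates the compact convex free set
from the translated cone `m ρ + {P ≥ 0}`, and the top eigenvector of the separating operator has all
its free overlaps bounded by a number below `m`, against the choice of `ψ`. Hence the max-relative
entropy of resource is at most `-log m` on all states. It dominates the other two quantities
(`Dmin_le_Dmax`, `neg_log_fidelity_le_Dmax`), and both of these equal `-log m` at `Φ`, since for a
pure state they are computed from the overlap. So all three are maximal at `Φ`.

For an exact map, let `τ` be a closest free state to `Φ`. Domination gives `D(Φ‖τ) ≤ -log m`, while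
concavity of the logarithm gives `D(Φ‖τ) ≥ -log ⟨ψ|τ|ψ⟩ ≥ -log m`. Equality forces `τ ψ = m ψ`,
whence `m Φ ≤ τ` and `D_max(Φ‖τ) ≤ -log m`. If `m = 0`, the upper bounds are `+∞` and hold
trivially. -/

namespace QResource

open Matrix

/-! ### Square roots and the spectral functional calculus -/

section SquareRoot

open scoped Matrix.Norms.L2Operator MatrixOrder

variable {d : ℕ}

/-- The square root is operator monotone. -/
theorem posSemidef_sub_of_mul_self {R S : Op d} (hR : R.PosSemidef) (hS : S.PosSemidef)
    (h : (S * S - R * R).PosSemidef) : (S - R).PosSemidef := by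
  have h0 : R * R ≤ S * S := Matrix.le_iff.2 h
  have h1 := CFC.sqrt_le_sqrt _ _ h0
  rw [CFC.sqrt_mul_self R (Matrix.nonneg_iff_posSemidef.2 hR),
    CFC.sqrt_mul_self S (Matrix.nonneg_iff_posSemidef.2 hS)] at h1
  exact Matrix.le_iff.1 h1

theorem eq_of_mul_self_eq {R S : Op d} (hR : R.PosSemidef) (hS : S.PosSemidef)
    (h : R * R = S * S) : R = S := by
  apply le_antisymm
  · exact Matrix.le_iff.2 (posSemidef_sub_of_mul_self hR hS (by rw [h, sub_self]; exact .zero))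
  · exact Matrix.le_iff.2 (posSemidef_sub_of_mul_self hS hR (by rw [h, sub_self]; exact .zero))

end SquareRoot

variable {d : ℕ}

theorem cfc_eq_conj_diagonal {A : Op d} (hA : A.IsHermitian) (f : ℝ → ℝ) :
    cfc f A = (hA.eigenvectorUnitary : Op d) * diagonal (fun i => (f (hA.eigenvalues i) : ℂ)) *
      (hA.eigenvectorUnitary : Op d)ᴴ := by
  rw [hA.cfc_eq, IsHermitian.cfc, Unitary.conjStarAlgAut_apply]
  rfl

theorem eq_conj_diagonal {A : Op d} (hA : A.IsHermitian) :
    A = (hA.eigenvectorUnitary : Op d) * diagonal (fun i => (hA.eigenvalues i : ℂ)) *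
      (hA.eigenvectorUnitary : Op d)ᴴ := by
  conv_lhs => rw [hA.spectral_theorem, Unitary.conjStarAlgAut_apply]
  rfl

theorem eigenvectorUnitary_conjTranspose_mul_self {A : Op d} (hA : A.IsHermitian) :
    (hA.eigenvectorUnitary : Op d)ᴴ * (hA.eigenvectorUnitary : Op d) = 1 :=
  Unitary.coe_star_mul_self _

theorem eigenvectorUnitary_mul_conjTranspose_self {A : Op d} (hA : A.IsHermitian) :
    (hA.eigenvectorUnitary : Op d) * (hA.eigenvectorUnitary : Op d)ᴴ = 1 :=
  Unitary.coe_mul_star_self _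

theorem posSemidef_cfc_sqrt {A : Op d} (hA : A.PosSemidef) : (cfc Real.sqrt A).PosSemidef := by
  rw [cfc_eq_conj_diagonal hA.1]
  refine (PosSemidef.diagonal fun i => ?_).mul_mul_conjTranspose_same _
  simp

theorem cfc_sqrt_mul_self {A : Op d} (hA : A.PosSemidef) :
    cfc Real.sqrt A * cfc Real.sqrt A = A := by
  conv_rhs => rw [eq_conj_diagonal hA.1]
  rw [cfc_eq_conj_diagonal hA.1]
  set U := (hA.1.eigenvectorUnitary : Op d)
  have hU : Uᴴ * U = 1 := eigenvectorUnitary_conjTranspose_mul_self hA.1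
  have h : ∀ D : Op d, U * D * Uᴴ * (U * D * Uᴴ) = U * (D * (Uᴴ * U) * D) * Uᴴ := fun D => by
    simp only [mul_assoc]
  rw [h, hU, mul_one, diagonal_mul_diagonal]
  congr 3
  ext i
  rw [← Complex.ofReal_mul, Real.mul_self_sqrt (hA.eigenvalues_nonneg i)]

theorem cfc_sqrt_eq {A R : Op d} (hR : R.PosSemidef) (h : R * R = A) : cfc Real.sqrt A = R := by
  have hA : A.PosSemidef := by
    have := posSemidef_conjTranspose_mul_self R
    rwa [hR.1.eq, h] at this
  exact eq_of_mul_self_eq (posSemidef_cfc_sqrt hA) hR ((cfc_sqrt_mul_self hA).trans h.symm)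

theorem trace_cfc {A : Op d} (hA : A.IsHermitian) (f : ℝ → ℝ) :
    (cfc f A).trace = ∑ i, (f (hA.eigenvalues i) : ℂ) := by
  rw [cfc_eq_conj_diagonal hA, trace_mul_comm, ← mul_assoc,
    eigenvectorUnitary_conjTranspose_mul_self, one_mul, trace_diagonal]

/-- `X Xᴴ` and `Xᴴ X` have the same characteristic polynomial, hence the same ordered eigenvalues.
-/
theorem trace_cfc_mul_conjTranspose (X : Op d) (f : ℝ → ℝ) :
    (cfc f (X * Xᴴ)).trace = (cfc f (Xᴴ * X)).trace := by
  rw [trace_cfc (isHermitian_mul_conjTranspose_self X),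
    trace_cfc (isHermitian_conjTranspose_mul_self X),
    (IsHermitian.eigenvalues_eq_eigenvalues_iff _
      (isHermitian_conjTranspose_mul_self X)).2 (charpoly_mul_comm _ _)]

/-! ### Fidelity: the bound from domination, and pure states -/

/-- The fidelity of `ρ` and `σ` is at least `c⁻¹` if `ρ ≤ c σ`. -/
theorem inv_le_fidelity {ρ σ : Op d} (hρ : ρ ∈ densityOps d) (hσ : σ.PosSemidef) {c : ℝ}
    (hc : 0 < c) (h : (c • σ - ρ).PosSemidef) : c⁻¹ ≤ fidelity ρ σ := by
  set P := cfc Real.sqrt ρ with hP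
  set Q := cfc Real.sqrt σ with hQ
  have hPP : P * P = ρ := cfc_sqrt_mul_self hρ.1
  have hQQ : Q * Q = σ := cfc_sqrt_mul_self hσ
  have hPs : P.PosSemidef := posSemidef_cfc_sqrt hρ.1
  have hQs : Q.PosSemidef := posSemidef_cfc_sqrt hσ
  have e1 : Q * ρ * Q = (Q * P) * (Q * P)ᴴ := by
    rw [conjTranspose_mul, hPs.1.eq, hQs.1.eq, ← hPP]; simp only [mul_assoc]
  have e2 : (Q * P)ᴴ * (Q * P) = P * σ * P := by
    rw [conjTranspose_mul, hPs.1.eq, hQs.1.eq, ← hQQ]; simp only [mul_assoc]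
  have hT : (P * σ * P).PosSemidef := by
    rw [← e2]; exact posSemidef_conjTranspose_mul_self _
  set S := cfc Real.sqrt (P * σ * P) with hS
  have hSs : S.PosSemidef := posSemidef_cfc_sqrt hT
  have hSS : S * S = P * σ * P := cfc_sqrt_mul_self hT
  have hsc : 0 < Real.sqrt c := Real.sqrt_pos.2 hc
  have hscc : Real.sqrt c * Real.sqrt c = c := Real.mul_self_sqrt hc.le
  -- Conjugating `ρ ≤ c σ` by `P = √ρ` gives `ρ² ≤ c S²`; operator monotonicity of the root then
  -- gives `ρ ≤ √c S`, and the trace `1 ≤ √c Tr S`.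
  have key : (Real.sqrt c • S - ρ).PosSemidef := by
    refine posSemidef_sub_of_mul_self hρ.1 (hSs.smul hsc.le) ?_
    have := h.mul_mul_conjTranspose_same P
    rw [hPs.1.eq] at this
    convert this using 1
    rw [smul_mul_smul_comm, hscc, hSS, mul_sub, sub_mul, ← hPP]
    simp only [mul_assoc, smul_mul_assoc, mul_smul_comm]
  have htr := key.trace_nonneg
  rw [trace_sub, trace_smul, hρ.2] at htr
  have htr' : 1 ≤ Real.sqrt c * S.trace.re := by
    have := (Complex.le_def.1 htr).1
    simpa using this
  -- `√σ ρ √σ = (QP)(QP)ᴴ` and `S² = (QP)ᴴ(QP)`, so their roots have equal trace.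
  have hf : fidelity ρ σ = S.trace.re ^ 2 := by
    rw [fidelity, ← hQ, e1, trace_cfc_mul_conjTranspose, e2]
  rw [hf, inv_le_iff_one_le_mul₀ hc]
  nlinarith

theorem trace_vecMulVec_mul (ψ : Fin d → ℂ) (M : Op d) :
    (vecMulVec ψ (star ψ) * M).trace = star ψ ⬝ᵥ (M *ᵥ ψ) := by
  rw [vecMulVec_mul, trace_vecMulVec, dotProduct_comm, dotProduct_mulVec]

theorem vecMulVec_mul_self {ψ : Fin d → ℂ} (hψ : star ψ ⬝ᵥ ψ = 1) :
    vecMulVec ψ (star ψ) * vecMulVec ψ (star ψ) = vecMulVec ψ (star ψ) := by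
  rw [vecMulVec_mul_vecMulVec, hψ, one_smul]

theorem pure_mem_densityOps {ψ : Fin d → ℂ} (hψ : star ψ ⬝ᵥ ψ = 1) :
    vecMulVec ψ (star ψ) ∈ densityOps d :=
  ⟨posSemidef_vecMulVec_self_star ψ, by rw [trace_vecMulVec, dotProduct_comm, hψ]⟩

/-- With `v = √σ ψ`, the operator under the root is the rank-one `|v⟩⟨v|`, whose root is `|v⟩⟨v| /
‖v‖`, of trace `‖v‖`; below, `a = ‖v‖`, and `a = 0` is treated apart. -/
theorem fidelity_pure (ψ : Fin d → ℂ) {σ : Op d} (hσ : σ.PosSemidef) :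
    fidelity (vecMulVec ψ (star ψ)) σ = (star ψ ⬝ᵥ (σ *ᵥ ψ)).re := by
  set Q := cfc Real.sqrt σ with hQ
  have hQQ : Q * Q = σ := cfc_sqrt_mul_self hσ
  have hQs : Q.PosSemidef := posSemidef_cfc_sqrt hσ
  set v := Q *ᵥ ψ with hv
  have e1 : Q * vecMulVec ψ (star ψ) * Q = vecMulVec v (star v) := by
    rw [mul_vecMulVec, vecMulVec_mul, hv, star_mulVec, hQs.1.eq]
  have e2 : star v ⬝ᵥ v = star ψ ⬝ᵥ (σ *ᵥ ψ) := by
    rw [hv, star_mulVec, hQs.1.eq, ← hQQ, ← mulVec_mulVec, ← dotProduct_mulVec]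
  obtain ⟨a, ha, hav⟩ : ∃ a : ℝ, 0 ≤ a ∧ star v ⬝ᵥ v = ((a * a : ℝ) : ℂ) := by
    have h0 : 0 ≤ star v ⬝ᵥ v := dotProduct_star_self_nonneg v
    obtain ⟨h1, h2⟩ := Complex.le_def.1 h0
    refine ⟨Real.sqrt (star v ⬝ᵥ v).re, Real.sqrt_nonneg _, ?_⟩
    rw [Real.mul_self_sqrt (by simpa using h1)]
    exact Complex.ext (by simp) (by simpa using h2.symm)
  have hroot : cfc Real.sqrt (vecMulVec v (star v)) = a⁻¹ • vecMulVec v (star v) := by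
    refine cfc_sqrt_eq ((posSemidef_vecMulVec_self_star v).smul (inv_nonneg.2 ha)) ?_
    rcases eq_or_ne a 0 with rfl | h0
    · have : v = 0 := by
        rw [mul_zero, Complex.ofReal_zero] at hav
        exact dotProduct_star_self_eq_zero.1 hav
      simp [this]
    · rw [smul_mul_smul_comm, vecMulVec_mul_vecMulVec, hav, Complex.coe_smul, vecMulVec_smul,
        smul_smul]
      field_simp
      simp
  rw [fidelity, ← hQ, e1, hroot, ← e2, hav, trace_smul, trace_vecMulVec, dotProduct_comm, hav]
  rcases eq_or_ne a 0 with rfl | h0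
  · simp
  · rw [Complex.real_smul, ← Complex.ofReal_mul, Complex.ofReal_re, Complex.ofReal_re]
    field_simp

/-! ### Support projectors and the min-relative entropy -/

theorem suppProj_mul_self (ρ : Op d) : suppProj ρ * ρ = ρ := by
  apply toEuclideanLin.injective
  have h : toEuclideanLin (suppProj ρ * ρ) =
      toEuclideanLin (suppProj ρ) ∘ₗ toEuclideanLin ρ := by
    ext x i
    simp [toLpLin_apply, mulVec_mulVec]
  rw [h, suppProj, LinearEquiv.apply_symm_apply]
  refine LinearMap.ext fun x => ?_
  exact Submodule.starProjection_eq_self_iff.2 (LinearMap.mem_range_self _ x)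

theorem posSemidef_suppProj (ρ : Op d) : (suppProj ρ).PosSemidef := by
  have hh : (suppProj ρ).IsHermitian := by
    rw [← isSymmetric_toEuclideanLin_iff, suppProj, LinearEquiv.apply_symm_apply]
    exact Submodule.starProjection_isSymmetric _
  have hi : suppProj ρ * suppProj ρ = suppProj ρ := by
    apply toEuclideanLin.injective
    have h : toEuclideanLin (suppProj ρ * suppProj ρ) =
        toEuclideanLin (suppProj ρ) ∘ₗ toEuclideanLin (suppProj ρ) := by
      ext x i
      simp [toLpLin_apply, mulVec_mulVec]
    rw [h, suppProj, LinearEquiv.apply_symm_apply]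
    refine LinearMap.ext fun x => ?_
    exact Submodule.starProjection_eq_self_iff.2 (Submodule.starProjection_apply_mem _ x)
  rw [← hi]
  conv => enter [1, 1]; rw [← hh.eq]
  exact posSemidef_conjTranspose_mul_self _

theorem mulVec_mem_supp (ρ : Op d) (x : Fin d → ℂ) : WithLp.toLp 2 (ρ *ᵥ x) ∈ supp ρ :=
  ⟨WithLp.toLp 2 x, by simp [toLpLin_apply]⟩

theorem suppProj_pure {ψ : Fin d → ℂ} (hψ : star ψ ⬝ᵥ ψ = 1) :
    suppProj (vecMulVec ψ (star ψ)) = vecMulVec ψ (star ψ) := by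
  apply toEuclideanLin.injective
  rw [suppProj, LinearEquiv.apply_symm_apply]
  refine LinearMap.ext fun x => ?_
  have hx : toEuclideanLin (vecMulVec ψ (star ψ)) x ∈ supp (vecMulVec ψ (star ψ)) :=
    LinearMap.mem_range_self _ x
  refine Submodule.eq_starProjection_of_mem_of_inner_eq_zero hx ?_
  rintro _ ⟨y, rfl⟩
  set Φ := vecMulVec ψ (star ψ) with hΦ
  have hs : (toEuclideanLin Φ).IsSymmetric :=
    isSymmetric_toEuclideanLin_iff.2 (posSemidef_vecMulVec_self_star ψ).1
  rw [← hs, map_sub]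
  have : toEuclideanLin Φ (toEuclideanLin Φ x) = toEuclideanLin Φ x := by
    simp only [toLpLin_apply, mulVec_mulVec, hΦ, vecMulVec_mul_self hψ]
  rw [this, sub_self, inner_zero_left]

theorem Dmin_pure {ψ : Fin d → ℂ} (hψ : star ψ ⬝ᵥ ψ = 1) (σ : Op d) :
    Dmin (vecMulVec ψ (star ψ)) σ =
      -ENNReal.log (ENNReal.ofReal (star ψ ⬝ᵥ (σ *ᵥ ψ)).re) := by
  rw [Dmin, suppProj_pure hψ, trace_vecMulVec_mul]

theorem trace_mul_nonneg {A B : Op d} (hA : A.PosSemidef) (hB : B.PosSemidef) :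
    0 ≤ (A * B).trace.re := by
  have h1 := (hB.mul_mul_conjTranspose_same (cfc Real.sqrt A)).trace_nonneg
  rw [(posSemidef_cfc_sqrt hA).1.eq, trace_mul_comm, ← mul_assoc, cfc_sqrt_mul_self hA] at h1
  simpa using (Complex.le_def.1 h1).1

theorem pos_of_posSemidef_smul_sub {ρ σ : Op d} (hρ : ρ ∈ densityOps d) {c : ℝ≥0}
    (h : ((c : ℝ) • σ - ρ).PosSemidef) : 0 < (c : ℝ) := by
  refine lt_of_le_of_ne c.2 fun h0 => ?_
  have := h.trace_nonneg
  rw [← h0, zero_smul, zero_sub, trace_neg, hρ.2] at this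
  have := (Complex.le_def.1 this).1
  norm_num at this

/-- Pair `c σ - ρ ≥ 0` with `Π_ρ ≥ 0` and use `Tr (Π_ρ ρ) = 1`. -/
theorem inv_le_trace_suppProj_mul {ρ σ : Op d} (hρ : ρ ∈ densityOps d) {c : ℝ} (hc : 0 < c)
    (h : (c • σ - ρ).PosSemidef) : c⁻¹ ≤ (suppProj ρ * σ).trace.re := by
  have := trace_mul_nonneg (posSemidef_suppProj ρ) h
  rw [mul_sub, suppProj_mul_self, trace_sub, hρ.2, mul_smul_comm, trace_smul] at this
  rw [inv_le_iff_one_le_mul₀ hc]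
  simp at this
  linarith

/-! ### Comparison with the max-relative entropy -/

theorem neg_log_le_Dmax {ρ σ : Op d} {t : ℝ} (hρ : ρ ∈ densityOps d)
    (h : ∀ c : ℝ, 0 < c → (c • σ - ρ).PosSemidef → c⁻¹ ≤ t) :
    -ENNReal.log (ENNReal.ofReal t) ≤ Dmax ρ σ := by
  rw [Dmax, ← ENNReal.log_inv]
  refine ENNReal.log_le_log (le_iInf₂ fun c hc => ?_)
  have hc0 := pos_of_posSemidef_smul_sub hρ hc
  rw [ENNReal.inv_le_iff_inv_le, ← ENNReal.ofReal_coe_nnreal, ← ENNReal.ofReal_inv_of_pos hc0]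
  exact ENNReal.ofReal_le_ofReal (h c hc0 hc)

theorem Dmin_le_Dmax {ρ σ : Op d} (hρ : ρ ∈ densityOps d) : Dmin ρ σ ≤ Dmax ρ σ :=
  neg_log_le_Dmax hρ fun _ hc h => inv_le_trace_suppProj_mul hρ hc h

theorem neg_log_fidelity_le_Dmax {ρ σ : Op d} (hρ : ρ ∈ densityOps d) (hσ : σ.PosSemidef) :
    -ENNReal.log (ENNReal.ofReal (fidelity ρ σ)) ≤ Dmax ρ σ :=
  neg_log_le_Dmax hρ fun _ hc h => inv_le_fidelity hρ hσ hc h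

theorem Dmax_le {ρ σ : Op d} {m : ℝ} (hm : 0 < m) (h : (m⁻¹ • σ - ρ).PosSemidef) :
    Dmax ρ σ ≤ -ENNReal.log (ENNReal.ofReal m) := by
  rw [Dmax, ← ENNReal.log_inv, ← ENNReal.ofReal_inv_of_pos hm]
  refine ENNReal.log_le_log ?_
  exact iInf₂_le_of_le (m⁻¹).toNNReal (by rwa [Real.coe_toNNReal _ (inv_nonneg.2 hm.le)]) le_rfl

theorem resDmin_le_resDmax {ρ : Op d} (hρ : ρ ∈ densityOps d) (F : Set (Op d)) :
    resDmin F ρ ≤ resDmax F ρ :=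
  iInf₂_mono fun _ _ => Dmin_le_Dmax hρ

theorem neg_log_freeFidelity_le_resDmax {ρ : Op d} (hρ : ρ ∈ densityOps d) {F : Set (Op d)}
    (hF : F ⊆ densityOps d) : -ENNReal.log (freeFidelity F ρ) ≤ resDmax F ρ := by
  refine le_iInf₂ fun σ hσ => le_trans ?_ (neg_log_fidelity_le_Dmax hρ (hF hσ).1)
  rw [EReal.neg_le_neg_iff]
  exact ENNReal.log_le_log (le_iSup₂_of_le σ hσ le_rfl)

/-! ### Overlaps of a pure state with the free states -/

/-- The largest overlap `max_{σ ∈ F} ⟨ψ|σ|ψ⟩` of a vector with the free states. -/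
noncomputable def freeOverlap (F : Set (Op d)) (ψ : Fin d → ℂ) : ℝ≥0∞ :=
  ⨆ σ ∈ F, ENNReal.ofReal (star ψ ⬝ᵥ (σ *ᵥ ψ)).re

theorem freeFidelity_pure {F : Set (Op d)} (hF : F ⊆ densityOps d) (ψ : Fin d → ℂ) :
    freeFidelity F (vecMulVec ψ (star ψ)) = freeOverlap F ψ :=
  iSup_congr fun _ => iSup_congr fun hσ => by rw [fidelity_pure ψ (hF hσ).1]

theorem resDmin_pure (F : Set (Op d)) {ψ : Fin d → ℂ} (hψ : star ψ ⬝ᵥ ψ = 1) :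
    resDmin F (vecMulVec ψ (star ψ)) = -ENNReal.log (freeOverlap F ψ) := by
  simp only [resDmin, freeOverlap, Dmin_pure hψ]
  have h := fun f : Op d → ℝ≥0∞ => ENNReal.logOrderIso.map_iSup₂ (fun σ (_ : σ ∈ F) => f σ)
  simp only [ENNReal.logOrderIso_apply] at h
  rw [h]
  apply le_antisymm
  · rw [EReal.le_neg]
    exact iSup₂_le fun σ hσ => by
      rw [EReal.le_neg]
      exact iInf₂_le σ hσ
  · refine le_iInf₂ fun σ hσ => EReal.neg_le_neg_iff.2 ?_
    exact le_iSup₂_of_le σ hσ le_rfl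

theorem freeOverlap_le_one {F : Set (Op d)} (hF : F ⊆ densityOps d) {ψ : Fin d → ℂ}
    (hψ : star ψ ⬝ᵥ ψ = 1) : freeOverlap F ψ ≤ 1 := by
  refine iSup₂_le fun σ hσ => ENNReal.ofReal_le_one.2 ?_
  have hP : (1 - vecMulVec ψ (star ψ)).PosSemidef := by
    have h : (1 - vecMulVec ψ (star ψ))ᴴ * (1 - vecMulVec ψ (star ψ)) =
        1 - vecMulVec ψ (star ψ) := by
      rw [conjTranspose_sub, conjTranspose_one, (posSemidef_vecMulVec_self_star ψ).1.eq, mul_sub,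
        sub_mul, sub_mul, vecMulVec_mul_self hψ]
      simp
    rw [← h]
    exact posSemidef_conjTranspose_mul_self _
  have := trace_mul_nonneg hP (hF hσ).1
  rw [sub_mul, one_mul, trace_sub, (hF hσ).2, trace_vecMulVec_mul] at this
  simpa using this

theorem dotProduct_conj_diagonal (U : Op d) (c : Fin d → ℝ) (ψ : Fin d → ℂ) :
    star ψ ⬝ᵥ ((U * diagonal (fun i => (c i : ℂ)) * Uᴴ) *ᵥ ψ) =
      ((∑ i, c i * Complex.normSq ((Uᴴ *ᵥ ψ) i) : ℝ) : ℂ) := by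
  rw [← mulVec_mulVec, ← mulVec_mulVec, dotProduct_mulVec]
  have : star ψ ᵥ* U = star (Uᴴ *ᵥ ψ) := by rw [star_mulVec, conjTranspose_conjTranspose]
  rw [this, dotProduct]
  push_cast
  refine Finset.sum_congr rfl fun i _ => ?_
  rw [mulVec_diagonal, Pi.star_apply, Complex.normSq_eq_conj_mul_self]
  simp only [Complex.star_def]
  ring

theorem sum_normSq_conjTranspose_mulVec {U : Op d} (hU : U * Uᴴ = 1) {ψ : Fin d → ℂ}
    (hψ : star ψ ⬝ᵥ ψ = 1) : ∑ i, Complex.normSq ((Uᴴ *ᵥ ψ) i) = 1 := by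
  have h := dotProduct_conj_diagonal U (fun _ => 1) ψ
  simp only [Complex.ofReal_one, diagonal_one, mul_one, hU, one_mulVec, hψ, one_mul] at h
  exact_mod_cast h.symm

/-! ### Duality: compactness of states and separation of convex sets -/

/-- Every real-linear functional on operators is, on Hermitian operators, of the form
`X ↦ Tr (W X)` with `W` Hermitian. -/
theorem exists_isHermitian_trace_eq (f : Op d →ₗ[ℝ] ℝ) :
    ∃ W : Op d, W.IsHermitian ∧ ∀ X : Op d, X.IsHermitian → f X = (W * X).trace.re := by
  -- The entry `a - i b`, with `a = f(E_ij)` and `b = f(i E_ij)`, is chosen so that `Re ((a - i b)(x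
  -- + i y)) = a x + b y`; the indices are swapped to match the trace.
  let V : Op d := fun j i => (f (single i j 1) : ℂ) - Complex.I * f (single i j Complex.I)
  have hV : ∀ X : Op d, f X = (V * X).trace.re := fun X => by
    have hX : X = ∑ i, ∑ j, ((X i j).re • single i j (1 : ℂ) +
        (X i j).im • single i j Complex.I) := by
      conv_lhs => rw [matrix_eq_sum_single X]
      refine Finset.sum_congr rfl fun i _ => Finset.sum_congr rfl fun j _ => ?_
      rw [smul_single, smul_single, ← single_add]
      congr 1
      simp [Complex.re_add_im]
    conv_lhs => rw [hX]
    simp only [map_sum, map_add, map_smul, trace, diag_apply, mul_apply, Complex.re_sum]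
    rw [Finset.sum_comm]
    refine Finset.sum_congr rfl fun i _ => Finset.sum_congr rfl fun j _ => ?_
    simp [V]
    ring
  refine ⟨(2⁻¹ : ℝ) • (V + Vᴴ), ?_, fun X hX => ?_⟩
  · rw [IsHermitian, conjTranspose_smul, conjTranspose_add, conjTranspose_conjTranspose, add_comm]
    simp
  · have h : (Vᴴ * X).trace.re = (V * X).trace.re := by
      have : Vᴴ * X = (X * V)ᴴ := by rw [conjTranspose_mul, hX.eq]
      rw [this, trace_conjTranspose, trace_mul_comm]
      simp
    rw [smul_mul_assoc, trace_smul, add_mul, trace_add, Complex.smul_re, Complex.add_re, h, hV X]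
    simp only [smul_eq_mul]
    ring

theorem isClosed_posSemidef : IsClosed {P : Op d | P.PosSemidef} := by
  have : {P : Op d | P.PosSemidef} =
      {P | Pᴴ = P} ∩ ⋂ x : Fin d → ℂ, {P : Op d | 0 ≤ star x ⬝ᵥ (P *ᵥ x)} := by
    ext P
    simp only [posSemidef_iff_dotProduct_mulVec, IsHermitian, Set.mem_ofPred_eq, Set.mem_inter_iff,
      Set.mem_iInter]
  rw [this]
  refine (isClosed_eq (by fun_prop) (by fun_prop)).inter (isClosed_iInter fun x => ?_)
  exact isClosed_le continuous_const (by fun_prop)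

theorem convex_posSemidef : Convex ℝ {P : Op d | P.PosSemidef} :=
  fun _ hP _ hQ _ _ ha hb _ => (hP.smul ha).add (hQ.smul hb)

/-- A state is `Bᴴ B` with `B = √ρ`, and `Tr ρ = 1` bounds every entry of `B` by 1. So the states
form a closed subset of the continuous image of a compact polydisc. -/
theorem isCompact_densityOps : IsCompact (densityOps d) := by
  let K : Set (Op d) := Set.univ.pi fun _ => Set.univ.pi fun _ => Metric.closedBall 0 1
  have hK : IsCompact K := isCompact_univ_pi fun _ => isCompact_univ_pi fun _ =>
    isCompact_closedBall _ _
  have hK' : IsCompact ((fun B : Op d => Bᴴ * B) '' K) := hK.image (by fun_prop)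
  have hcl : IsClosed (densityOps d) :=
    isClosed_posSemidef.inter (isClosed_eq (by fun_prop) continuous_const)
  refine hK'.of_isClosed_subset hcl ?_
  rintro ρ ⟨hρ, htr⟩
  refine ⟨cfc Real.sqrt ρ, fun i _ j _ => ?_, ?_⟩
  · set B := cfc Real.sqrt ρ with hB
    have hBB : Bᴴ * B = ρ := by rw [(posSemidef_cfc_sqrt hρ).1.eq, cfc_sqrt_mul_self hρ]
    have h1 : ∑ j, ∑ i, Complex.normSq (B i j) = 1 := by
      have h2 : (Bᴴ * B).trace = ((∑ j, ∑ i, Complex.normSq (B i j) : ℝ) : ℂ) := by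
        simp only [trace, diag_apply, mul_apply, conjTranspose_apply]
        push_cast
        simp only [Complex.normSq_eq_conj_mul_self, Complex.star_def]
      rw [hBB, htr] at h2
      exact_mod_cast h2.symm
    have h3 : Complex.normSq (B i j) ≤ 1 := by
      rw [← h1]
      refine le_trans ?_ (Finset.single_le_sum (f := fun j => ∑ i, Complex.normSq (B i j))
        (fun j _ => Finset.sum_nonneg fun i _ => Complex.normSq_nonneg _) (Finset.mem_univ j))
      exact Finset.single_le_sum (f := fun i => Complex.normSq (B i j))
        (fun i _ => Complex.normSq_nonneg _) (Finset.mem_univ i)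
    rw [mem_closedBall_zero_iff]
    rw [Complex.normSq_eq_norm_sq] at h3
    nlinarith [norm_nonneg (B i j)]
  · change (cfc Real.sqrt ρ)ᴴ * cfc Real.sqrt ρ = ρ
    rw [(posSemidef_cfc_sqrt hρ).1.eq, cfc_sqrt_mul_self hρ]

theorem norm_le_one_of_dotProduct_star_self {ψ : Fin d → ℂ} (hψ : star ψ ⬝ᵥ ψ = 1) (i : Fin d) :
    ‖ψ i‖ ≤ 1 := by
  have h : ((∑ i, Complex.normSq (ψ i) : ℝ) : ℂ) = 1 := by
    rw [← hψ, dotProduct]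
    push_cast
    simp only [Complex.normSq_eq_conj_mul_self, Pi.star_apply, Complex.star_def]
  have h' : ∑ i, Complex.normSq (ψ i) = 1 := by exact_mod_cast h
  have h3 : Complex.normSq (ψ i) ≤ 1 := by
    rw [← h']
    exact Finset.single_le_sum (f := fun i => Complex.normSq (ψ i))
      (fun i _ => Complex.normSq_nonneg _) (Finset.mem_univ i)
  rw [Complex.normSq_eq_norm_sq] at h3
  nlinarith [norm_nonneg (ψ i)]

/-- A supremum of continuous functions is lower semicontinuous, so it attains its minimum on the
compact unit sphere. -/
theorem exists_isMinOn_freeOverlap (hd : 0 < d) (F : Set (Op d)) :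
    ∃ ψ ∈ {ψ : Fin d → ℂ | star ψ ⬝ᵥ ψ = 1},
      IsMinOn (freeOverlap F) {ψ : Fin d → ℂ | star ψ ⬝ᵥ ψ = 1} ψ := by
  refine LowerSemicontinuousOn.exists_isMinOn ?_ ?_ ?_
  · exact ⟨Pi.single ⟨0, hd⟩ 1, by simp⟩
  · refine (isCompact_univ_pi fun _ : Fin d =>
      isCompact_closedBall (0 : ℂ) 1).of_isClosed_subset ?_ fun ψ hψ i _ => ?_
    · exact isClosed_eq (by fun_prop) continuous_const
    · simpa using norm_le_one_of_dotProduct_star_self hψ i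
  · refine (lowerSemicontinuous_biSup fun σ _ => Continuous.lowerSemicontinuous ?_)
      |>.lowerSemicontinuousOn _
    refine ENNReal.continuous_ofReal.comp (Complex.continuous_re.comp ?_)
    fun_prop

/-- A convex compact set of states which dominates no multiple `m ρ` of some state `ρ` has, for some
unit vector, all overlaps bounded away from `m`. -/
theorem exists_overlap_lt {F : Set (Op d)} (hF : F ⊆ densityOps d) (hne : F.Nonempty)
    (hcl : IsClosed F) (hcv : Convex ℝ F) {m : ℝ} (hm : 0 < m) {ρ : Op d}
    (hρ : ρ ∈ densityOps d) (h : ∀ σ ∈ F, ¬ (σ - m • ρ).PosSemidef) :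
    ∃ ψ : Fin d → ℂ, star ψ ⬝ᵥ ψ = 1 ∧
      ∃ t < m, ∀ σ ∈ F, (star ψ ⬝ᵥ (σ *ᵥ ψ)).re ≤ t := by
  let _ : LocallyConvexSpace ℝ (Op d) :=
    inferInstanceAs (LocallyConvexSpace ℝ (Fin d → Fin d → ℂ))
  have hFc : IsCompact F := isCompact_densityOps.of_isClosed_subset hcl hF
  let T : Set (Op d) := (fun X => X - m • ρ) ⁻¹' {P | P.PosSemidef}
  have hT : IsClosed T := isClosed_posSemidef.preimage (by fun_prop)
  have hTc : Convex ℝ T := by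
    have := convex_posSemidef (d := d).translate_preimage_left (-(m • ρ))
    simpa [T, sub_eq_add_neg] using this
  obtain ⟨f, u, v, hu, huv, hv⟩ := geometric_hahn_banach_compact_closed hcv hFc hTc hT
    (Set.disjoint_left.2 fun σ hσ hσT => h σ hσ hσT)
  obtain ⟨W, hW, hfW⟩ := exists_isHermitian_trace_eq (f : Op d →ₗ[ℝ] ℝ)
  have hfW' : ∀ X : Op d, X.IsHermitian → f X = (W * X).trace.re := hfW
  have hadd : ∀ P : Op d, P.PosSemidef → v < m * f ρ + f P := fun P hP => by
    have := hv (m • ρ + P) (by simpa [T] using hP)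
    simpa using this
  -- If `f P < 0`, moving along the ray of `P` would bring `m f(ρ) + t f(P)` down to exactly `v`;
  -- the `t` that does so is the quotient below.
  have hpos : ∀ P : Op d, P.PosSemidef → 0 ≤ f P := fun P hP => by
    by_contra! hneg
    have h0 : 0 ≤ (m * f ρ - v) / (-f P) :=
      div_nonneg (by have := hadd 0 .zero; simp at this; linarith) (by linarith)
    have := hadd _ (hP.smul h0)
    rw [map_smul, smul_eq_mul] at this
    have h2 : (m * f ρ - v) / (-f P) * f P = -(m * f ρ - v) := by
      have := hneg.ne
      field_simp
    linarith
  set U := (hW.eigenvectorUnitary : Op d) with hUdef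
  have hU : U * Uᴴ = 1 := eigenvectorUnitary_mul_conjTranspose_self hW
  have hU' : Uᴴ * U = 1 := eigenvectorUnitary_conjTranspose_mul_self hW
  set w := hW.eigenvalues with hw
  have hWU : W = U * diagonal (fun i => (w i : ℂ)) * Uᴴ := eq_conj_diagonal hW
  have htr : ∀ X : Op d, (W * X).trace.re = ∑ i, w i * ((Uᴴ * X * U) i i).re := fun X => by
    have : (W * X).trace = (diagonal (fun i => (w i : ℂ)) * (Uᴴ * X * U)).trace := by
      rw [hWU, mul_assoc, mul_assoc, trace_mul_comm]
      simp only [mul_assoc]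
    rw [this, trace, Complex.re_sum]
    simp [diagonal_mul]
  have hWps : W.PosSemidef := by
    refine PosSemidef.of_dotProduct_mulVec_nonneg hW fun x => ?_
    have h1 := hpos _ (posSemidef_vecMulVec_self_star x)
    rw [hfW' _ (posSemidef_vecMulVec_self_star x).1, trace_mul_comm, trace_vecMulVec_mul] at h1
    rw [hWU, dotProduct_conj_diagonal, Complex.ofReal_re] at h1
    rw [hWU, dotProduct_conj_diagonal]
    exact_mod_cast h1
  have hw0 : ∀ i, 0 ≤ w i := hWps.eigenvalues_nonneg
  have hd : Nonempty (Fin d) := by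
    by_contra hemp
    rw [not_nonempty_iff] at hemp
    have := hρ.2
    simp [trace] at this
  obtain ⟨k, hk⟩ := Finite.exists_max w
  have hXd : ∀ X : Op d, X.PosSemidef → ∀ i, 0 ≤ ((Uᴴ * X * U) i i).re := fun X hX i => by
    simpa using (Complex.le_def.1 (hX.conjTranspose_mul_mul_same U).diag_nonneg).1
  -- `f ρ` averages the eigenvalues of `W` with weights summing to 1, so the top eigenvalue bounds
  -- it.
  have hρk : f ρ ≤ w k := by
    rw [hfW' ρ hρ.1.1, htr]
    have h1 : ∑ i, ((Uᴴ * ρ * U) i i).re = 1 := by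
      have : (Uᴴ * ρ * U).trace = 1 := by
        rw [trace_mul_comm, ← mul_assoc, hU, one_mul, hρ.2]
      rw [trace] at this
      simpa using congrArg Complex.re this
    calc ∑ i, w i * ((Uᴴ * ρ * U) i i).re ≤ ∑ i, w k * ((Uᴴ * ρ * U) i i).re :=
          Finset.sum_le_sum fun i _ => mul_le_mul_of_nonneg_right (hk i) (hXd ρ hρ.1 i)
      _ = w k := by rw [← Finset.mul_sum, h1, mul_one]
  let ψ : Fin d → ℂ := U *ᵥ Pi.single k 1
  have hψ : star ψ ⬝ᵥ ψ = 1 := by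
    rw [star_mulVec, dotProduct_mulVec, vecMul_vecMul, hU', vecMul_one]
    simp
  -- Only the `k`-th term of the trace is kept; the others are nonnegative because `W ≥ 0`.
  have hσk : ∀ σ ∈ F, w k * (star ψ ⬝ᵥ (σ *ᵥ ψ)).re ≤ f σ := fun σ hσ => by
    have h1 : star ψ ⬝ᵥ (σ *ᵥ ψ) = (Uᴴ * σ * U) k k := by
      rw [star_mulVec, mulVec_mulVec, dotProduct_mulVec, vecMul_vecMul, ← mul_assoc]
      simp
    rw [h1, hfW' σ (hF hσ).1.1, htr]
    exact Finset.single_le_sum (f := fun i => w i * ((Uᴴ * σ * U) i i).re)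
      (fun i _ => mul_nonneg (hw0 i) (hXd σ (hF hσ).1 i)) (Finset.mem_univ k)
  have hvm : v < m * w k := by
    have := hadd 0 .zero
    rw [map_zero, add_zero] at this
    exact this.trans_le (mul_le_mul_of_nonneg_left hρk hm.le)
  have hu0 : 0 ≤ u := by
    obtain ⟨σ, hσ⟩ := hne
    exact (hpos σ (hF hσ).1).trans (hu σ hσ).le
  have hwk : 0 < w k := by
    by_contra! h0
    nlinarith
  -- On `F`, `w k ⟨ψ|σ|ψ⟩ ≤ f σ < u`, while `u < v < m * w k`.
  refine ⟨ψ, hψ, u / w k, ?_, fun σ hσ => ?_⟩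
  · rw [div_lt_iff₀ hwk]
    linarith
  · rw [le_div_iff₀ hwk, mul_comm]
    exact (hσk σ hσ).trans (hu σ hσ).le

/-- If `ψ` has the least maximal overlap `m` with the free states, then every state `ρ` satisfies
`m ρ ≤ σ` for some free state `σ`. -/
theorem exists_posSemidef_sub_smul {F : Set (Op d)} (hF : F ⊆ densityOps d) (hne : F.Nonempty)
    (hcl : IsClosed F) (hcv : Convex ℝ F) {m : ℝ} (hm : 0 < m)
    (hmin : ∀ ψ : Fin d → ℂ, star ψ ⬝ᵥ ψ = 1 → ENNReal.ofReal m ≤ freeOverlap F ψ) {ρ : Op d}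
    (hρ : ρ ∈ densityOps d) : ∃ σ ∈ F, (σ - m • ρ).PosSemidef := by
  by_contra! h
  obtain ⟨ψ, hψ, t, htm, ht⟩ := exists_overlap_lt hF hne hcl hcv hm hρ h
  have h1 : freeOverlap F ψ ≤ ENNReal.ofReal t :=
    iSup₂_le fun σ hσ => ENNReal.ofReal_le_ofReal (ht σ hσ)
  exact absurd ((hmin ψ hψ).trans h1) (not_le.2 ((ENNReal.ofReal_lt_ofReal_iff hm).2 htm))

/-! ### Relative entropy of a pure state -/

/-- The eigenvalues of a projector are 0 and 1, and `Real.log` vanishes at both. -/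
theorem cfc_log_pure {ψ : Fin d → ℂ} (hψ : star ψ ⬝ᵥ ψ = 1) :
    cfc Real.log (vecMulVec ψ (star ψ)) = 0 := by
  have hh : (vecMulVec ψ (star ψ)).IsHermitian := (posSemidef_vecMulVec_self_star ψ).1
  have hid := vecMulVec_mul_self hψ
  rw [cfc_eq_conj_diagonal hh]
  have hD : ∀ i, Real.log (hh.eigenvalues i) = 0 := fun i => by
    set U := (hh.eigenvectorUnitary : Op d)
    have hU : Uᴴ * U = 1 := eigenvectorUnitary_conjTranspose_mul_self hh
    have hsp := eq_conj_diagonal hh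
    set D : Op d := diagonal fun i => (hh.eigenvalues i : ℂ) with hDdef
    have hD : D = Uᴴ * vecMulVec ψ (star ψ) * U := by
      have : Uᴴ * (U * D * Uᴴ) * U = (Uᴴ * U) * D * (Uᴴ * U) := by simp only [mul_assoc]
      rw [hsp, this, hU, one_mul, mul_one]
    have hDD : D * D = D := by
      have h2 : Uᴴ * (U * D * Uᴴ * (U * D * Uᴴ)) * U =
          (Uᴴ * U) * D * (Uᴴ * U) * D * (Uᴴ * U) := by simp only [mul_assoc]
      have h3 : Uᴴ * (vecMulVec ψ (star ψ) * vecMulVec ψ (star ψ)) * U = D * D := by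
        rw [hsp, h2, hU, one_mul, mul_one, mul_one]
      rw [← h3, hid, ← hD]
    have := congrFun (congrFun hDD i) i
    rw [hDdef, diagonal_mul_diagonal, diagonal_apply_eq, diagonal_apply_eq] at this
    have h4 : hh.eigenvalues i * hh.eigenvalues i = hh.eigenvalues i := by exact_mod_cast this
    rcases eq_or_ne (hh.eigenvalues i) 0 with h0 | h0
    · rw [h0, Real.log_zero]
    · rw [mul_left_cancel₀ h0 (h4.trans (mul_one _).symm), Real.log_one]
  simp [hD]

/-- The weight of a vector on the `i`-th eigenvector of a Hermitian operator. -/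
noncomputable def eigenWeight {σ : Op d} (hσ : σ.IsHermitian) (ψ : Fin d → ℂ) (i : Fin d) : ℝ :=
  Complex.normSq (((hσ.eigenvectorUnitary : Op d)ᴴ *ᵥ ψ) i)

theorem eigenWeight_nonneg {σ : Op d} (hσ : σ.IsHermitian) (ψ : Fin d → ℂ) (i : Fin d) :
    0 ≤ eigenWeight hσ ψ i :=
  Complex.normSq_nonneg _

theorem sum_eigenWeight {σ : Op d} (hσ : σ.IsHermitian) {ψ : Fin d → ℂ} (hψ : star ψ ⬝ᵥ ψ = 1) :
    ∑ i, eigenWeight hσ ψ i = 1 :=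
  sum_normSq_conjTranspose_mulVec (eigenvectorUnitary_mul_conjTranspose_self hσ) hψ

theorem sum_eigenvalues_mul_eigenWeight {σ : Op d} (hσ : σ.IsHermitian) (ψ : Fin d → ℂ) :
    ∑ i, hσ.eigenvalues i * eigenWeight hσ ψ i = (star ψ ⬝ᵥ (σ *ᵥ ψ)).re := by
  conv_rhs => rw [eq_conj_diagonal hσ]
  rw [dotProduct_conj_diagonal, Complex.ofReal_re]
  rfl

theorem relEntropy_pure {ψ : Fin d → ℂ} (hψ : star ψ ⬝ᵥ ψ = 1) {σ : Op d} (hσ : σ.IsHermitian)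
    (h : supp (vecMulVec ψ (star ψ)) ≤ supp σ) :
    relEntropy (vecMulVec ψ (star ψ)) σ =
      ((-∑ i, Real.log (hσ.eigenvalues i) * eigenWeight hσ ψ i : ℝ) : EReal) := by
  rw [relEntropy, if_pos h, cfc_log_pure hψ, mul_zero, zero_sub, trace_neg, Complex.neg_re,
    trace_vecMulVec_mul, cfc_eq_conj_diagonal hσ,
    dotProduct_conj_diagonal _ (fun i => Real.log (hσ.eigenvalues i)), Complex.ofReal_re]
  rfl

theorem conjTranspose_eigenvectorUnitary_mulVec {σ : Op d} (hσ : σ.IsHermitian) (x : Fin d → ℂ)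
    (i : Fin d) : ((hσ.eigenvectorUnitary : Op d)ᴴ *ᵥ (σ *ᵥ x)) i =
      hσ.eigenvalues i * ((hσ.eigenvectorUnitary : Op d)ᴴ *ᵥ x) i := by
  have h : (hσ.eigenvectorUnitary : Op d)ᴴ * σ =
      diagonal (fun i => (hσ.eigenvalues i : ℂ)) * (hσ.eigenvectorUnitary : Op d)ᴴ := by
    refine (congrArg _ (eq_conj_diagonal hσ)).trans ?_
    rw [← mul_assoc, ← mul_assoc, eigenvectorUnitary_conjTranspose_mul_self, one_mul]
  rw [mulVec_mulVec, h, ← mulVec_mulVec, mulVec_diagonal]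

theorem conjTranspose_eigenvectorUnitary_mulVec_injective {σ : Op d} (hσ : σ.IsHermitian) :
    Function.Injective ((hσ.eigenvectorUnitary : Op d)ᴴ *ᵥ · : (Fin d → ℂ) → Fin d → ℂ) := by
  intro x y h
  have := congrArg ((hσ.eigenvectorUnitary : Op d) *ᵥ ·) h
  simpa [mulVec_mulVec, eigenvectorUnitary_mul_conjTranspose_self] using this

/-- Both sides say that `ψ` lies in the range of `σ`; in the eigenbasis a preimage is found by
dividing by the nonzero eigenvalues. -/
theorem supp_pure_le_iff {ψ : Fin d → ℂ} (hψ : star ψ ⬝ᵥ ψ = 1) {σ : Op d} (hσ : σ.IsHermitian) :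
    supp (vecMulVec ψ (star ψ)) ≤ supp σ ↔
      ∀ i, hσ.eigenvalues i = 0 → eigenWeight hσ ψ i = 0 := by
  constructor
  · intro h i hi
    have h1 := h (mulVec_mem_supp (vecMulVec ψ (star ψ)) ψ)
    rw [vecMulVec_mulVec, hψ] at h1
    obtain ⟨x, hx⟩ := h1
    have hx' : ψ = σ *ᵥ x.ofLp := by
      have := congrArg WithLp.ofLp hx
      simpa [toLpLin_apply] using this.symm
    rw [eigenWeight, hx', conjTranspose_eigenvectorUnitary_mulVec, hi]
    simp
  · intro h
    set U := (hσ.eigenvectorUnitary : Op d) with hU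
    have hUU : Uᴴ * U = 1 := eigenvectorUnitary_conjTranspose_mul_self hσ
    have hx : σ *ᵥ (U *ᵥ fun i => ((hσ.eigenvalues i)⁻¹ : ℂ) * (Uᴴ *ᵥ ψ) i) = ψ := by
      apply conjTranspose_eigenvectorUnitary_mulVec_injective hσ
      funext i
      simp only
      rw [conjTranspose_eigenvectorUnitary_mulVec, ← hU, mulVec_mulVec, hUU, one_mulVec]
      rcases eq_or_ne (hσ.eigenvalues i) 0 with h0 | h0
      · have := Complex.normSq_eq_zero.1 (h i h0)
        rw [← hU] at this
        rw [this, mul_zero, mul_zero]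
      · rw [← mul_assoc, mul_inv_cancel₀ (by exact_mod_cast h0), one_mul]
    rintro _ ⟨y, rfl⟩
    have h1 : toEuclideanLin (vecMulVec ψ (star ψ)) y = (star ψ ⬝ᵥ y.ofLp) • WithLp.toLp 2 ψ := by
      ext i
      simp [toLpLin_apply, vecMulVec_mulVec, mul_comm]
    rw [h1]
    refine (supp σ).smul_mem _ ?_
    rw [← hx]
    exact mulVec_mem_supp _ _

/-- `D(ψ‖σ) ≤ -log m` if `m |ψ⟩⟨ψ| ≤ σ`. -/
theorem relEntropy_pure_le {ψ : Fin d → ℂ} (hψ : star ψ ⬝ᵥ ψ = 1) {σ : Op d} (hσ : σ.PosSemidef)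
    {m : ℝ} (hm : 0 < m) (h : (σ - m • vecMulVec ψ (star ψ)).PosSemidef) :
    relEntropy (vecMulVec ψ (star ψ)) σ ≤ ((-Real.log m : ℝ) : EReal) := by
  set U := (hσ.1.eigenvectorUnitary : Op d) with hU
  set l := hσ.1.eigenvalues with hl
  set p := eigenWeight hσ.1 ψ with hp
  set y := Uᴴ *ᵥ ψ with hy
  have hpn : ∀ i, 0 ≤ p i := eigenWeight_nonneg hσ.1 ψ
  have hln : ∀ i, 0 ≤ l i := hσ.eigenvalues_nonneg
  have hpy : ∀ i, star (y i) * y i = (p i : ℂ) := fun i =>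
    (Complex.normSq_eq_conj_mul_self).symm
  have hUU : Uᴴ * U = 1 := eigenvectorUnitary_conjTranspose_mul_self hσ.1
  have hdiag : (diagonal (fun i => (l i : ℂ)) - m • vecMulVec y (star y)).PosSemidef := by
    have h1 := h.conjTranspose_mul_mul_same U
    have h2 : Uᴴ * σ * U = diagonal fun i => (l i : ℂ) := by
      conv_lhs => rw [eq_conj_diagonal hσ.1]
      rw [← hU, ← mul_assoc, ← mul_assoc, hUU, one_mul, mul_assoc, hUU, mul_one]
    have h3 : Uᴴ * vecMulVec ψ (star ψ) * U = vecMulVec y (star y) := by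
      rw [mul_vecMulVec, vecMulVec_mul, hy, star_mulVec, conjTranspose_conjTranspose]
    rwa [mul_sub, sub_mul, h2, mul_smul_comm, smul_mul_assoc, h3] at h1
  -- The inequality `m |y⟩⟨y| ≤ diag(l)`, tested on the vector with entries `c i * y i`.
  have hquad : ∀ c : Fin d → ℝ, m * (∑ i, c i * p i) ^ 2 ≤ ∑ i, l i * c i ^ 2 * p i := fun c => by
    have h1 := hdiag.dotProduct_mulVec_nonneg fun i => c i * y i
    set z : Fin d → ℂ := fun i => c i * y i with hz
    have h2 : star z ⬝ᵥ (diagonal (fun i => (l i : ℂ)) *ᵥ z) =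
        ((∑ i, l i * c i ^ 2 * p i : ℝ) : ℂ) := by
      rw [dotProduct]
      push_cast
      refine Finset.sum_congr rfl fun i _ => ?_
      rw [mulVec_diagonal, ← hpy]
      simp only [hz, Pi.star_apply, star_mul', Complex.star_def, Complex.conj_ofReal]
      ring
    have h3 : star y ⬝ᵥ z = ((∑ i, c i * p i : ℝ) : ℂ) := by
      rw [dotProduct]
      push_cast
      refine Finset.sum_congr rfl fun i _ => ?_
      rw [← hpy]
      simp only [hz, Pi.star_apply]
      ring
    have h4 : star z ⬝ᵥ y = ((∑ i, c i * p i : ℝ) : ℂ) := by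
      have := congrArg star h3
      rw [← star_dotProduct_star, star_star] at this
      rw [dotProduct_comm, dotProduct_comm] at this
      simpa using this
    rw [sub_mulVec, dotProduct_sub, h2, smul_mulVec, vecMulVec_mulVec, h3, dotProduct_smul] at h1
    simp only [dotProduct_smul, h4, op_smul_eq_smul, smul_eq_mul, Complex.real_smul] at h1
    have h5 : (0 : ℝ) ≤ ∑ i, l i * c i ^ 2 * p i - m * ((∑ i, c i * p i) * ∑ i, c i * p i) := by
      exact_mod_cast h1
    nlinarith
  have hsingle : ∀ i, l i = 0 → p i = 0 := fun i hi => by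
    have := hquad (Pi.single i 1)
    simp only [Pi.single_apply, ite_mul, one_mul, zero_mul, Finset.sum_ite_eq', Finset.mem_univ,
      if_true, ite_pow, one_pow, mul_ite, mul_one] at this
    simp [hi] at this
    have h2 : p i ^ 2 ≤ 0 := by nlinarith
    exact pow_eq_zero_iff two_ne_zero |>.1 (le_antisymm h2 (sq_nonneg _))
  -- Taking `c i = (l i)⁻¹` gives `m s² ≤ s` for `s = ∑ p i / l i`, hence `m s ≤ 1`. The convention
  -- `0⁻¹ = 0` drops the kernel of `σ`.
  have hC : m * ∑ i, (l i)⁻¹ * p i ≤ 1 := by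
    have h1 := hquad fun i => (l i)⁻¹
    have h2 : ∀ i, l i * (l i)⁻¹ ^ 2 * p i = (l i)⁻¹ * p i := fun i => by
      rcases eq_or_ne (l i) 0 with h0 | h0
      · simp [h0]
      · field_simp
    simp only [h2] at h1
    have h3 : 0 ≤ ∑ i, (l i)⁻¹ * p i :=
      Finset.sum_nonneg fun i _ => mul_nonneg (inv_nonneg.2 (hln i)) (hpn i)
    rcases h3.eq_or_lt with h4 | h4
    · rw [← h4]; simp
    · by_contra! h5
      nlinarith
  rw [relEntropy_pure hψ hσ.1 ((supp_pure_le_iff hψ hσ.1).2 hsingle)]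
  refine EReal.coe_le_coe_iff.2 (neg_le_neg ?_)
  -- `log x ≤ x - 1` at `x = m / l i`; summed over `i`, the left side is `1 + log m - m s ≥ log m`.
  have hterm : ∀ i, (1 + Real.log m) * p i - m * ((l i)⁻¹ * p i) ≤ Real.log (l i) * p i := by
    intro i
    rcases (hln i).eq_or_lt with h0 | h0
    · simp [hsingle i h0.symm]
    · have h1 := Real.log_le_sub_one_of_pos (mul_pos hm (inv_pos.2 h0))
      rw [Real.log_mul hm.ne' (inv_pos.2 h0).ne', Real.log_inv] at h1
      nlinarith [hpn i]
  have hsum := Finset.sum_le_sum fun i (_ : i ∈ Finset.univ) => hterm i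
  rw [Finset.sum_sub_distrib, ← Finset.mul_sum, ← Finset.mul_sum, hp, sum_eigenWeight hσ.1 hψ]
    at hsum
  linarith

/-- The equality case of `D(ψ‖σ) ≥ -log ⟨ψ|σ|ψ⟩`. -/
theorem mulVec_eq_smul_of_relEntropy_le {ψ : Fin d → ℂ} (hψ : star ψ ⬝ᵥ ψ = 1) {σ : Op d}
    (hσ : σ.PosSemidef) {m : ℝ} (hm : 0 < m) (hov : (star ψ ⬝ᵥ (σ *ᵥ ψ)).re ≤ m)
    (h : relEntropy (vecMulVec ψ (star ψ)) σ ≤ ((-Real.log m : ℝ) : EReal)) :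
    σ *ᵥ ψ = m • ψ := by
  have hsupp : supp (vecMulVec ψ (star ψ)) ≤ supp σ := by
    by_contra hn
    rw [relEntropy, if_neg hn] at h
    exact absurd h (not_le.2 (EReal.coe_lt_top _))
  rw [relEntropy_pure hψ hσ.1 hsupp, EReal.coe_le_coe_iff, neg_le_neg_iff] at h
  have hzero := (supp_pure_le_iff hψ hσ.1).1 hsupp
  rw [← sum_eigenvalues_mul_eigenWeight hσ.1] at hov
  have hsum := sum_eigenWeight hσ.1 hψ
  have hln : ∀ i, 0 ≤ hσ.1.eigenvalues i := hσ.eigenvalues_nonneg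
  have hpn := eigenWeight_nonneg hσ.1 ψ
  -- `log x ≤ x - 1` at `x = l i / m`. The right sides sum to at most `log m`, the left sides to at
  -- least `log m`, so every term is an equality.
  have hterm : ∀ i, Real.log (hσ.1.eigenvalues i) * eigenWeight hσ.1 ψ i ≤
      m⁻¹ * (hσ.1.eigenvalues i * eigenWeight hσ.1 ψ i) +
        (Real.log m - 1) * eigenWeight hσ.1 ψ i := by
    intro i
    rcases (hln i).eq_or_lt with h0 | h0
    · simp [hzero i h0.symm]
    · have h1 := Real.log_le_sub_one_of_pos (mul_pos (inv_pos.2 hm) h0)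
      rw [Real.log_mul (inv_pos.2 hm).ne' h0.ne', Real.log_inv] at h1
      nlinarith [hpn i]
  have htot : ∑ i, (m⁻¹ * (hσ.1.eigenvalues i * eigenWeight hσ.1 ψ i) +
      (Real.log m - 1) * eigenWeight hσ.1 ψ i) ≤ Real.log m := by
    rw [Finset.sum_add_distrib, ← Finset.mul_sum, ← Finset.mul_sum, hsum]
    have : m⁻¹ * ∑ i, hσ.1.eigenvalues i * eigenWeight hσ.1 ψ i ≤ 1 := by
      rw [inv_mul_le_iff₀ hm, mul_one]
      exact hov
    linarith
  -- The inequality for the logarithm is strict away from `x = 1`, so `ψ` has weight only on the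
  -- eigenvalue `m`.
  have heq : ∀ i, eigenWeight hσ.1 ψ i ≠ 0 → hσ.1.eigenvalues i = m := by
    intro i hi
    by_contra hne
    have h0 : 0 < hσ.1.eigenvalues i := (hln i).lt_of_ne fun h0 => hi (hzero i h0.symm)
    have h1 : Real.log (m⁻¹ * hσ.1.eigenvalues i) < m⁻¹ * hσ.1.eigenvalues i - 1 := by
      refine Real.log_lt_sub_one_of_pos (mul_pos (inv_pos.2 hm) h0) fun h2 => hne ?_
      field_simp at h2
      exact h2
    rw [Real.log_mul (inv_pos.2 hm).ne' h0.ne', Real.log_inv] at h1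
    have h2 := Finset.sum_lt_sum (s := Finset.univ) (fun i _ => hterm i) ⟨i, Finset.mem_univ i, by
      nlinarith [(hpn i).lt_of_ne hi.symm]⟩
    linarith
  apply conjTranspose_eigenvectorUnitary_mulVec_injective hσ.1
  funext i
  simp only
  rw [conjTranspose_eigenvectorUnitary_mulVec, mulVec_smul, Pi.smul_apply, Complex.real_smul]
  by_cases hi : eigenWeight hσ.1 ψ i = 0
  · rw [Complex.normSq_eq_zero.1 hi, mul_zero, mul_zero]
  · rw [heq i hi]

/-- Since `ψ` is an eigenvector, `σ - m Φ` is the compression of `σ` to the orthogonal complement of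
`ψ`. -/
theorem posSemidef_inv_smul_sub_pure {ψ : Fin d → ℂ} (hψ : star ψ ⬝ᵥ ψ = 1) {σ : Op d}
    (hσ : σ.PosSemidef) {m : ℝ} (hm : 0 < m) (h : σ *ᵥ ψ = m • ψ) :
    (m⁻¹ • σ - vecMulVec ψ (star ψ)).PosSemidef := by
  set Φ := vecMulVec ψ (star ψ) with hΦ
  have hΦh : Φᴴ = Φ := (posSemidef_vecMulVec_self_star ψ).1
  have h1 : σ * Φ = m • Φ := by rw [hΦ, mul_vecMulVec, h, smul_vecMulVec]
  have h2 : Φ * σ = m • Φ := by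
    have := congrArg conjTranspose h1
    rwa [conjTranspose_mul, hσ.1.eq, conjTranspose_smul, hΦh, star_trivial] at this
  have h3 : (1 - Φ) * σ * (1 - Φ)ᴴ = σ - m • Φ := by
    rw [conjTranspose_sub, conjTranspose_one, hΦh, sub_mul, one_mul, h2, mul_sub, mul_one, sub_mul,
      h1, smul_mul_assoc, vecMulVec_mul_self hψ, sub_self, sub_zero]
  have h4 := (hσ.mul_mul_conjTranspose_same (1 - Φ)).smul (inv_nonneg.2 hm.le)
  rwa [h3, smul_sub, smul_smul, inv_mul_cancel₀ hm.ne', one_smul] at h4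

/-! ### The golden state and the theorem -/

/-- A pure state which minimizes the maximal overlap with a closed convex set of free states
maximizes the max-relative entropy of resource, and its closest free states in relative entropy are
also optimal for the max-relative entropy. -/
theorem exists_golden_state (hd : 0 < d) {F : Set (Op d)} (hF : F ⊆ densityOps d)
    (hne : F.Nonempty) (hcl : IsClosed F) (hcv : Convex ℝ F) :
    ∃ ψ : Fin d → ℂ, star ψ ⬝ᵥ ψ = 1 ∧
      (∀ ρ ∈ densityOps d, resDmax F ρ ≤ -ENNReal.log (freeOverlap F ψ)) ∧
      ∀ τ ∈ F, relEntropy (vecMulVec ψ (star ψ)) τ =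
          (⨅ σ ∈ F, relEntropy (vecMulVec ψ (star ψ)) σ) →
        Dmax (vecMulVec ψ (star ψ)) τ ≤ -ENNReal.log (freeOverlap F ψ) := by
  obtain ⟨ψ, hψ, hmin⟩ := exists_isMinOn_freeOverlap hd F
  replace hψ : star ψ ⬝ᵥ ψ = 1 := hψ
  refine ⟨ψ, hψ, ?_⟩
  rcases eq_or_ne (freeOverlap F ψ) 0 with h0 | h0
  · simp [h0]
  have hfin : freeOverlap F ψ ≠ ⊤ :=
    ne_top_of_le_ne_top ENNReal.one_ne_top (freeOverlap_le_one hF hψ)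
  obtain ⟨m, hm, hmo⟩ : ∃ m : ℝ, 0 < m ∧ freeOverlap F ψ = ENNReal.ofReal m :=
    ⟨_, ENNReal.toReal_pos h0 hfin, (ENNReal.ofReal_toReal hfin).symm⟩
  have hdom : ∀ ρ ∈ densityOps d, ∃ σ ∈ F, (σ - m • ρ).PosSemidef := fun ρ hρ =>
    exists_posSemidef_sub_smul hF hne hcl hcv hm (fun φ hφ => hmo ▸ hmin hφ) hρ
  rw [hmo]
  refine ⟨fun ρ hρ => ?_, fun τ hτ hτmin => Dmax_le hm ?_⟩
  · obtain ⟨σ, hσ, hps⟩ := hdom ρ hρ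
    refine iInf₂_le_of_le σ hσ (Dmax_le hm ?_)
    have := hps.smul (inv_nonneg.2 hm.le)
    rwa [smul_sub, smul_smul, inv_mul_cancel₀ hm.ne', one_smul] at this
  · obtain ⟨σ, hσ, hps⟩ := hdom _ (pure_mem_densityOps hψ)
    refine posSemidef_inv_smul_sub_pure hψ (hF hτ).1 hm
      (mulVec_eq_smul_of_relEntropy_le hψ (hF hτ).1 hm ?_ ?_)
    · have h1 : ENNReal.ofReal (star ψ ⬝ᵥ (τ *ᵥ ψ)).re ≤ ENNReal.ofReal m :=
        hmo ▸ le_iSup₂_of_le (f := fun σ (_ : σ ∈ F) => ENNReal.ofReal (star ψ ⬝ᵥ (σ *ᵥ ψ)).re)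
          τ hτ le_rfl
      exact (ENNReal.ofReal_le_ofReal_iff hm.le).1 h1
    -- The closest free state does at least as well as the free state that dominates `m |ψ⟩⟨ψ|`.
    · rw [hτmin]
      exact iInf₂_le_of_le σ hσ (relEntropy_pure_le hψ (hF hσ).1 hm hps)

end QResource

theorem theorem1 (R : QResource.ResourceTheory) (hCH : R.ConditionCH)
    (d : ℕ) (hd : d ∈ R.dims) (hd2 : 2 ≤ d) :
    ∃ Φ ∈ QResource.densityOps d, QResource.IsPure Φ ∧
      ∃ g : EReal,
        (QResource.mF (R.free d) Φ = g ∧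
          QResource.mMin (R.free d) Φ = g ∧
          QResource.mMax (R.free d) Φ = g) ∧
        (IsMaxOn (QResource.mF (R.free d)) (QResource.densityOps d) Φ ∧
          IsMaxOn (QResource.mMin (R.free d)) (QResource.densityOps d) Φ ∧
          IsMaxOn (QResource.mMax (R.free d)) (QResource.densityOps d) Φ) ∧
        ∀ Λ : QResource.Op d → QResource.Op d, QResource.IsExactRDMap (R.free d) Λ →
          QResource.mFMap Λ Φ = g ∧
          QResource.mMinMap Λ Φ = g ∧
          QResource.mMaxMap Λ Φ = g := by
  have hF := R.free_subset d hd
  have hcv : Convex ℝ (R.free d) := by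
    rw [hCH d hd]
    exact convex_convexHull ℝ _
  obtain ⟨ψ, hψ, hmax, hclosest⟩ := QResource.exists_golden_state (by omega) hF
    (R.free_nonempty d hd) (R.free_closed d hd) hcv
  have hΦ := QResource.pure_mem_densityOps hψ
  have hFid := QResource.freeFidelity_pure hF ψ
  have hMin := QResource.resDmin_pure (R.free d) hψ
  have hMax : QResource.resDmax (R.free d) (Matrix.vecMulVec ψ (star ψ)) =
      -ENNReal.log (QResource.freeOverlap (R.free d) ψ) :=
    le_antisymm (hmax _ hΦ) (hMin ▸ QResource.resDmin_le_resDmax hΦ _)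
  have hlog : (0 : EReal) ≤ (Real.log d : EReal) :=
    EReal.coe_nonneg.2 (Real.log_natCast_nonneg d)
  refine ⟨_, hΦ, ⟨ψ, hψ, rfl⟩,
    -ENNReal.log (QResource.freeOverlap (R.free d) ψ) / (Real.log d : EReal),
    ⟨by rw [QResource.mF, hFid], by rw [QResource.mMin, hMin], by rw [QResource.mMax, hMax]⟩,
    ⟨?_, ?_, ?_⟩, fun Λ hΛ => ?_⟩
  · refine fun ρ hρ => EReal.div_le_div_right_of_nonneg hlog ?_
    rw [hFid]
    exact (QResource.neg_log_freeFidelity_le_resDmax hρ hF).trans (hmax ρ hρ)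
  · refine fun ρ hρ => EReal.div_le_div_right_of_nonneg hlog ?_
    rw [hMin]
    exact (QResource.resDmin_le_resDmax hρ _).trans (hmax ρ hρ)
  · refine fun ρ hρ => EReal.div_le_div_right_of_nonneg hlog ?_
    rw [hMax]
    exact hmax ρ hρ
  · set Φ := Matrix.vecMulVec ψ (star ψ) with hΦdef
    have hτ : Λ Φ ∈ R.free d := by
      by_cases h : Φ ∈ R.free d
      · rwa [hΛ.fixes Φ h]
      · exact hΛ.destroys Φ hΦ h
    have h1 : -ENNReal.log (QResource.freeOverlap (R.free d) ψ) ≤ QResource.Dmin Φ (Λ Φ) :=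
      hMin ▸ iInf₂_le _ hτ
    have h2 := QResource.Dmin_le_Dmax (σ := Λ Φ) hΦ
    have h3 := hclosest _ hτ (hΛ.closest Φ hΦ)
    -- `-log m ≤ D_min ≤ D_max ≤ -log m` at the pair `(Φ, Λ Φ)`, so both entropies equal `-log m`;
    -- the fidelity term coincides with `D_min` because `Φ` is pure.
    have hDmin := le_antisymm (h2.trans h3) h1
    have hDmax := le_antisymm h3 (h1.trans h2)
    refine ⟨?_, by rw [QResource.mMinMap, hDmin], by rw [QResource.mMaxMap, hDmax]⟩
    rw [QResource.mFMap, QResource.fidelity_pure ψ (hF hτ).1, ← QResource.Dmin_pure hψ, hDmin]
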